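/- Let $p$ be a prime, $\mathbb F_q$ a finite field of characteristic $p$, $R_T=\mathbb F_q[T]$ and $k=\mathbb F_q(T)$. Let $K/k$ be a cyclic extension of degree $p^n$, $n\ge 1$, and let $P_1,\dots,P_r$ be the distinct monic irreducible polynomials in $R_T$ whose places ramify in $K/k$ (the place at infinity may ramify as well). For a Witt vector $\vec y=(y_1,\dots,y_n)$ of length $n$ write $\vec y^{\,p}=(y_1^p,\dots,y_n^p)$, and let $\dot+$ and $\dot-$ denote Witt vector addition and subtraction. Then there are Witt vectors $\vec y\in W_n(K)$ and $\vec\beta,\vec\delta_1,\dots,\vec\delta_r,\vec\mu\in W_n(k)$ such that $K=k(\vec y)=k(y_1,\dots,y_n)$ and $$\vec y^{\,p}\;\dot-\;\vec y=\vec\beta=\vec\delta_1\,\dot+\cdots\dot+\,\vec\delta_r\,\dot+\,\vec\mu ,$$ where the first component satisfies $\beta_1\notin\wp(k)=\{a^p-a : a\in k\}$, and the following hold. (1) For all $1\le i\le r$ and $1\le j\le n$, the $j$-th component of $\vec\delta_i$ is $\delta_{ij}=Q_{ij}/P_i^{e_{ij}}$ with $Q_{ij}\in R_T$ and $e_{ij}\ge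 0$. If $e_{ij}>0$, then $p\nmid e_{ij}$, $\gcd(Q_{ij},P_i)=1$ and $\deg Q_{ij}<\deg P_i^{e_{ij}}$. If $e_{ij}=0$, then $\delta_{ij}=0$. In particular $\delta_{ij}$ has no pole, finite or infinite, other than $P_i$. (2) For all $1\le j\le n$, the $j$-th component of $\vec\mu$ is a polynomial $\mu_j=f_j(T)\in R_T$, with $p\nmid\deg f_j$ when $f_j\notin\mathbb F_q$. -/

import Mathlib

open Polynomial

noncomputable section

namespace CyclicWitt

/-- The image of a Witt vector of length `n` under a ring homomorphism, applied to each component.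
For `f = algebraMap k K` this is the inclusion `W_n(k) → W_n(K)`. -/
def wittMap {p n : ℕ} {R S : Type*} [CommRing R] [CommRing S] (f : R →+* S)
    (x : TruncatedWittVector p n R) : TruncatedWittVector p n S :=
  TruncatedWittVector.mk p fun j => f (x.coeff j)

/-- The componentwise `p`-th power of a Witt vector `y = (y_1, …, y_n)`, that is, the vector
`(y_1 ^ p, …, y_n ^ p)`. (It is not the `p`-fold Witt product of `y` with itself.) -/
def wittFrob {p n : ℕ} {R : Type*} [CommRing R]
    (y : TruncatedWittVector p n R) : TruncatedWittVector p n R :=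
  TruncatedWittVector.mk p fun j => y.coeff j ^ p

/-- The place of `F(X)` given by the polynomial `P` ramifies in `K`: some prime ideal of the
integral closure of `F[X]` in `K` lying over `(P)` has ramification index greater than `1`. -/
def IsRamified (F : Type*) [Field F] (K : Type*) [Field K] [Algebra F[X] K] (P : F[X]) : Prop :=
  ∃ Q : Ideal (FunctionField.ringOfIntegers F K),
    Q.IsPrime ∧ Q.LiesOver (Ideal.span {P}) ∧ 1 < Q.ramificationIdx F[X]

end CyclicWitt

end

/-! ### Components of sums of Witt vectors, and a Witt vector form of additive Hilbert 90 -/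

namespace WittVector

variable {p : ℕ} [Fact p.Prime] {R : Type*} [CommRing R]

/-! Everything is done in full Witt vectors and read modulo the kernel of `truncate n`. In
characteristic `p` the componentwise `p`-th power is the Frobenius map, written Φ here.

Let σ generate the Galois group. Additive Hilbert 90 (`exists_map_eq_add_one`) gives `w` with σw = w
+ 1 in length `n`. Then Φw - w is fixed by σ, so it comes from some β₀ over k. Partial fractions,
applied one component at a time (`exists_witt_decomposition`), write β₀ as Σ δ_P + μ + (Φz - z) with
normalized components. Replacing `w` by `y = w - z` removes the last term and keeps σy = y + 1. This
relation makes the components of `y` generate K and keeps the first component of β out of ℘(k).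

The sum so far runs over all poles P that occurred. If P is unramified, a prime of K above P gives a
valuation in which P has value exactly one step. A nonzero component of δ_P would have a pole of
order prime to `p`, whereas an element a^p - a has pole order divisible by `p`; hence δ_P vanishes
in length `n` (`coeff_eq_zero_of_not_isRamified`) and only ramified primes remain. -/

theorem truncate_eq_truncate_iff {n : ℕ} {x y : WittVector p R} :
    truncate n x = truncate n y ↔ ∀ i < n, x.coeff i = y.coeff i := by
  constructor
  · intro h i hi
    have := congrArg (TruncatedWittVector.coeff ⟨i, hi⟩) h
    simpa using this
  · intro h
    refine TruncatedWittVector.ext fun i => ?_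
    simpa using h i i.2

/-- Split `a` at index `n`: its tail is an n-fold Verschiebung and absorbs that of `b` by
additivity, while its initial segment has disjoint support and produces no carries. -/
theorem coeff_add_iterate_verschiebung (a b : WittVector p R) (n : ℕ) :
    (a + verschiebung^[n] b).coeff n = a.coeff n + b.coeff 0 := by
  have htail : tail n a = verschiebung^[n] ((tail n a).shift n) :=
    eq_iterate_verschiebung fun i hi => by simp [tail, select, hi]
  have hsum : a + verschiebung^[n] b =
      init n a + verschiebung^[n] ((tail n a).shift n + b) := by
    rw [iterate_map_add, ← htail, ← add_assoc, init_add_tail]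
  have hshift : ((tail n a).shift n).coeff 0 = a.coeff n := by
    simp [shift_coeff, tail, select]
  rw [hsum, coeff_add_of_disjoint]
  · have := iterate_verschiebung_coeff ((tail n a).shift n + b) n 0
    rw [zero_add] at this
    rw [this, add_coeff_zero, hshift]
    simp [init, select]
  · intro i
    rcases lt_or_ge i n with hi | hi
    · exact Or.inr (iterate_verschiebung_coeff_eq_zero _ hi)
    · exact Or.inl (by simp [init, select, hi])

/-- Both vectors lift to Witt vectors over the ring `A`, where the sum can be formed. -/
theorem coeff_add_mem (A : Subring R) {x y : WittVector p R}
    (hx : ∀ i, x.coeff i ∈ A) (hy : ∀ i, y.coeff i ∈ A) (i : ℕ) : (x + y).coeff i ∈ A := by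
  have h : ∀ z : WittVector p R, (∀ i, z.coeff i ∈ A) →
      ∃ z' : WittVector p A, map A.subtype z' = z := fun z hz =>
    ⟨mk p fun i => ⟨z.coeff i, hz i⟩, by ext i; simp⟩
  obtain ⟨x, rfl⟩ := h x hx
  obtain ⟨y, rfl⟩ := h y hy
  rw [← map_add, map_coeff]
  exact ((x + y).coeff i).2

/-- The carry into component `n` depends only on the components below `n`: it is component `n` of
the sum of the two initial segments. So nothing is required of the components at `n` themselves. -/
theorem coeff_add_sub_mem (A : Subring R) {x y : WittVector p R} {n : ℕ}
    (hx : ∀ i < n, x.coeff i ∈ A) (hy : ∀ i < n, y.coeff i ∈ A) :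
    (x + y).coeff n - x.coeff n - y.coeff n ∈ A := by
  have hinit : ∀ z : WittVector p R, (∀ i < n, z.coeff i ∈ A) → ∀ i, (init n z).coeff i ∈ A := by
    intro z hz i
    simp only [init, select, coeff_mk]
    split_ifs with hi
    exacts [hz i hi, A.zero_mem]
  have htail : ∀ z : WittVector p R, tail n z = verschiebung^[n] ((tail n z).shift n) :=
    fun z => eq_iterate_verschiebung fun i hi => by simp [tail, select, hi]
  have hshift : ∀ z : WittVector p R, ((tail n z).shift n).coeff 0 = z.coeff n := by
    intro z
    simp [shift_coeff, tail, select]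
  have hsum : x + y = (init n x + init n y) +
      verschiebung^[n] ((tail n x).shift n + (tail n y).shift n) := by
    rw [iterate_map_add, ← htail, ← htail]
    conv_lhs => rw [← init_add_tail x n, ← init_add_tail y n]
    ring
  rw [hsum, coeff_add_iterate_verschiebung, add_coeff_zero, hshift, hshift]
  convert coeff_add_mem A (hinit x hx) (hinit y hy) n using 1
  ring

/-- Used with `A` a valuation ring: up to integral terms, the first component where δ may have a
pole satisfies a scalar Artin–Schreier equation. Below that index the same relation and `hA` make
the components of `y` integral one after another, so all carries are integral. -/
theorem artinSchreier_coeff_mem [CharP R p] (A : Subring R)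
    (hA : ∀ a : R, a ^ p - a ∈ A → a ∈ A) {n : ℕ} {y δ γ : WittVector p R}
    (h : truncate n (frobenius y) = truncate n (y + (δ + γ)))
    (hγ : ∀ i < n, γ.coeff i ∈ A) {j : ℕ} (hj : j < n) (hδ : ∀ i < j, δ.coeff i ∈ A) :
    y.coeff j ^ p - y.coeff j - δ.coeff j ∈ A := by
  have hsum : ∀ i ≤ j, (δ + γ).coeff i - δ.coeff i ∈ A := fun i hi => by
    have := coeff_add_sub_mem A (n := i) (x := δ) (y := γ)
      (fun l hl => hδ l (by omega)) (fun l hl => hγ l (by omega))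
    simpa using A.add_mem this (hγ i (by omega))
  have key : ∀ i ≤ j, (∀ l < i, y.coeff l ∈ A) →
      y.coeff i ^ p - y.coeff i - δ.coeff i ∈ A := fun i hi hy => by
    have h1 := truncate_eq_truncate_iff.1 h i (by omega)
    rw [coeff_frobenius_charP] at h1
    have h2 := coeff_add_sub_mem A hy (y := δ + γ) fun l hl => by
      simpa using A.add_mem (hsum l (by omega)) (hδ l (by omega))
    rw [← h1] at h2
    convert A.add_mem h2 (hsum i hi) using 1
    ring
  refine key j le_rfl fun l hl => ?_
  induction l using Nat.strong_induction_on with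
  | _ l ih =>
    refine hA _ ?_
    simpa using A.add_mem (key l hl.le fun m hm => ih m hm (hm.trans hl)) (hδ l hl)

/-- Additive Hilbert 90 for truncated Witt vectors of a cyclic extension. -/
theorem exists_map_eq_add_one {k K : Type*} [Field k] [Field K] [Algebra k K]
    [FiniteDimensional k K] [IsGalois k K] [CharP K p] {n : ℕ}
    (hdeg : Module.finrank k K = p ^ n) {σ : K ≃ₐ[k] K}
    (hσ : ∀ τ, τ ∈ Subgroup.zpowers σ) :
    ∃ y : WittVector p K, truncate n (map (σ : K →+* K) y) = truncate n (y + 1) := by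
  classical
  set N := p ^ n with hN
  have hord : orderOf σ = N := by
    rw [orderOf_eq_card_of_forall_mem_zpowers hσ, IsGalois.card_aut_eq_finrank, hdeg]
  -- An element of nonzero trace: the trace of its Teichmüller lift then has nonzero component 0,
  -- hence is a unit in the Witt vectors over K.
  obtain ⟨c, hc⟩ : ∃ c : K, ∑ i ∈ Finset.range N, (σ ^ i) c ≠ 0 := by
    obtain ⟨c, hc⟩ := Algebra.trace_surjective k K 1
    refine ⟨c, ?_⟩
    have h1 := trace_eq_sum_automorphisms (K := k) (L := K) c
    rw [hc, map_one] at h1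
    have h2 : ∑ i ∈ Finset.range N, (σ ^ i) c = ∑ τ : K ≃ₐ[k] K, τ c := by
      rw [← hord]
      refine Finset.sum_bij (fun i _ => σ ^ i) (fun _ _ => Finset.mem_univ _) ?_ ?_ (fun _ _ => rfl)
      · intro a ha b hb hab
        exact pow_injOn_Iio_orderOf (by simpa using ha) (by simpa using hb) hab
      · intro τ _
        obtain ⟨m, hm, rfl⟩ := (mem_zpowers_iff_mem_range_orderOf.1 (hσ τ) |> Finset.mem_image.1)
        exact ⟨m, hm, rfl⟩
    rw [h2, ← h1]
    exact one_ne_zero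
  let s : WittVector p K →+* WittVector p K := map (σ : K →+* K)
  let C : WittVector p K := teichmuller p c
  let d : ℕ → WittVector p K := fun i => s^[i] C
  have hd : ∀ i, s (d i) = d (i + 1) := fun i => (Function.iterate_succ_apply' s i C).symm
  have hdc : ∀ i, d i = teichmuller p ((σ ^ i) c) := by
    intro i
    induction i with
    | zero => simp [d, C]
    | succ i ih => rw [← hd, ih, map_teichmuller, pow_succ']; rfl
  have hdN : d N = d 0 := by rw [hdc, hdc, ← hord, pow_orderOf_eq_one, pow_zero]
  let t := ∑ i ∈ Finset.range N, d i
  have ht : s t = t := by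
    simp only [t, map_sum, hd]
    have := Finset.sum_range_succ' d N
    rw [Finset.sum_range_succ, hdN] at this
    exact (add_right_cancel this).symm
  have htu : IsUnit t := by
    refine isUnit_of_coeff_zero_ne_zero t ?_
    have : t.coeff 0 = ∑ i ∈ Finset.range N, (σ ^ i) c := by
      change constantCoeff t = _
      simp only [t, map_sum, hdc]
      exact Finset.sum_congr rfl fun i _ => teichmuller_coeff_zero p _
    rwa [this]
  obtain ⟨u, hu⟩ := htu
  have hsu : s (↑u⁻¹ : WittVector p K) = ↑u⁻¹ := by
    have h1 : t * s (↑u⁻¹ : WittVector p K) = 1 := by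
      conv_lhs => rw [← ht, ← map_mul, ← hu, Units.mul_inv, map_one]
    exact eq_comm.1 (Units.inv_eq_of_mul_eq_one_right (hu ▸ h1))
  -- The classical Hilbert 90 sum: applying σ shifts the weights by one, at the cost of the trace
  -- `t` and a boundary term `N * d 0`. Dividing by `-t` gives σy = y + 1 up to a multiple of `N = p
  -- ^ n`, which dies in length `n`.
  let z := ∑ i ∈ Finset.range N, (i : WittVector p K) * d i
  have hz : s z = z - t + N * d 0 := by
    have h1 : s z = ∑ i ∈ Finset.range N, (i : WittVector p K) * d (i + 1) := by
      simp [z, map_sum, hd]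
    have h2 := Finset.sum_range_succ' (fun i => ((i : WittVector p K) - 1) * d i) N
    rw [Finset.sum_range_succ] at h2
    simp only [Nat.cast_add, Nat.cast_one, add_sub_cancel_right, sub_mul, one_mul,
      Finset.sum_sub_distrib, hdN, Nat.cast_zero, zero_mul] at h2
    rw [h1]
    linear_combination -h2
  refine ⟨-(z * ↑u⁻¹), ?_⟩
  have hNtrunc : truncate n (N : WittVector p K) = 0 := by
    refine (mem_ker_truncate _ _).2 fun i hi => ?_
    rw [hN, Nat.cast_pow]
    exact coeff_p_pow_eq_zero p K hi.ne
  have h3 : s (-(z * ↑u⁻¹)) = -(z * ↑u⁻¹) + 1 - N * d 0 * ↑u⁻¹ := by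
    rw [map_neg, map_mul, hsu, hz, ← hu]
    linear_combination (Units.mul_inv u)
  change truncate n (s (-(z * ↑u⁻¹))) = _
  rw [h3, map_sub, map_mul, map_mul, hNtrunc]
  simp

end WittVector

/-! ### Partial fractions over F(X) modulo elements b^p - b -/

namespace CyclicWitt

variable {F : Type*} [Field F]

/-- `a` is a proper fraction `Q / P ^ e` which is zero or has `Q` prime to `P` and `p ∤ e`. -/
def IsNormalizedAt (p : ℕ) (P : F[X]) (a : RatFunc F) : Prop :=
  ∃ (Q : F[X]) (e : ℕ),
    a = algebraMap F[X] (RatFunc F) Q / algebraMap F[X] (RatFunc F) (P ^ e) ∧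
    (e = 0 → Q = 0) ∧
    (0 < e → ¬ p ∣ e ∧ IsCoprime Q P ∧ Q.degree < (P ^ e).degree)

/-- `a` is a constant polynomial or a polynomial of degree prime to `p`. -/
def IsNormalizedAtInfinity (p : ℕ) (a : RatFunc F) : Prop :=
  ∃ f : F[X], a = algebraMap F[X] (RatFunc F) f ∧ ((¬ ∃ c : F, f = C c) → ¬ p ∣ f.natDegree)

theorem isNormalizedAt_zero (p : ℕ) (P : F[X]) : IsNormalizedAt p P 0 :=
  ⟨0, 0, by simp, fun _ => rfl, fun h => absurd h (lt_irrefl _)⟩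

theorem isNormalizedAtInfinity_zero (p : ℕ) : IsNormalizedAtInfinity p (0 : RatFunc F) :=
  ⟨0, by simp, fun h => absurd ⟨0, by simp⟩ h⟩

variable {p : ℕ} [Fact p.Prime] [Finite F] [CharP F p]

/-- The residue field at `P` is finite, hence perfect. -/
theorem exists_dvd_sub_pow {P : F[X]} (hP : Irreducible P) (Q : F[X]) :
    ∃ a : F[X], a.degree < P.degree ∧ P ∣ Q - a ^ p := by
  have : Fact (Irreducible P) := ⟨hP⟩
  have : Module.Finite F (AdjoinRoot P) := (AdjoinRoot.powerBasis hP.ne_zero).finite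
  have : Finite (AdjoinRoot P) := Module.finite_of_finite F
  have : CharP (AdjoinRoot P) p := charP_of_injective_algebraMap (algebraMap F _).injective p
  obtain ⟨b, hb⟩ := surjective_frobenius (AdjoinRoot P) p (AdjoinRoot.mk P Q)
  obtain ⟨a, rfl⟩ := AdjoinRoot.mk_surjective b
  refine ⟨a % P, EuclideanDomain.mod_lt a hP.ne_zero, ?_⟩
  have h : AdjoinRoot.mk P (a % P) = AdjoinRoot.mk P a :=
    AdjoinRoot.mk_eq_mk.2 ⟨-(a / P), by
      linear_combination EuclideanDomain.div_add_mod a P⟩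
  rw [← AdjoinRoot.mk_eq_mk, map_pow, h, ← hb, frobenius_def]

/-- A pole of order divisible by `p` can be lowered by an Artin–Schreier element. The fraction stays
proper throughout, so no pole at infinity is created. -/
theorem exists_isNormalizedAt {P : F[X]} (hP : Irreducible P) (e : ℕ) (Q : F[X])
    (hQ : Q.degree < (P ^ e).degree) :
    ∃ a b : RatFunc F, IsNormalizedAt p P a ∧
      algebraMap F[X] (RatFunc F) Q / algebraMap F[X] (RatFunc F) (P ^ e) = a + (b ^ p - b) := by
  have hp : p.Prime := Fact.out
  have hP0 : algebraMap F[X] (RatFunc F) P ≠ 0 := by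
    simpa using hP.ne_zero
  have : CharP (RatFunc F) p := charP_of_injective_algebraMap (algebraMap F _).injective p
  induction e generalizing Q with
  | zero =>
    have : Q = 0 := by
      rw [← degree_eq_bot]
      simpa using hQ
    exact ⟨0, 0, isNormalizedAt_zero p P, by simp [this, hp.ne_zero]⟩
  | succ e ih =>
    have hdiv : ∀ S : F[X], P ∣ S → S.degree < (P ^ (e + 1)).degree →
        ∃ a b : RatFunc F, IsNormalizedAt p P a ∧ algebraMap F[X] (RatFunc F) S /
          algebraMap F[X] (RatFunc F) (P ^ (e + 1)) = a + (b ^ p - b) := by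
      rintro _ ⟨S, rfl⟩ hS
      rw [pow_succ', degree_mul, degree_mul] at hS
      have hS' : S.degree < (P ^ e).degree := lt_of_add_lt_add_left hS
      obtain ⟨a, b, ha, hab⟩ := ih S hS'
      refine ⟨a, b, ha, ?_⟩
      rw [← hab, pow_succ', map_mul, map_mul, mul_div_mul_left _ _ hP0]
    by_cases hPQ : P ∣ Q
    · exact hdiv Q hPQ hQ
    by_cases hpe : p ∣ e + 1
    · obtain ⟨m, hm⟩ := hpe
      have hm0 : 0 < m := by
        rcases Nat.eq_zero_or_pos m with rfl | h
        · simp at hm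
        · exact h
      have hme : m < e + 1 := by
        rw [hm]
        exact lt_mul_of_one_lt_left hm0 hp.one_lt
      -- With `e + 1 = p * m`, subtracting (c/P^m)^p - c/P^m turns the numerator into `Q - c ^ p + c
      -- * P ^ (e + 1 - m)`. It is divisible by `P`, because `c ^ p` matches `Q` modulo `P` and `m <
      -- e + 1`.
      obtain ⟨c, hc, hcd⟩ := exists_dvd_sub_pow (p := p) hP Q
      have hcn : c.natDegree < P.natDegree := by
        rcases eq_or_ne c 0 with rfl | hc0
        · simpa using hP.natDegree_pos
        · exact natDegree_lt_natDegree hc0 hc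
      have hdeg : (Q - c ^ p + c * P ^ (e + 1 - m)).degree < (P ^ (e + 1)).degree := by
        have hPe : (P ^ (e + 1)).degree = ((e + 1) * P.natDegree : ℕ) := by
          rw [degree_eq_natDegree (pow_ne_zero _ hP.ne_zero), natDegree_pow]
        have hd : ∀ S : F[X], S.natDegree < (e + 1) * P.natDegree →
            S.degree < (P ^ (e + 1)).degree := fun S hS => by
          rw [hPe]
          exact lt_of_le_of_lt degree_le_natDegree (by exact_mod_cast hS)
        refine lt_of_le_of_lt (degree_add_le _ _) (max_lt
          (lt_of_le_of_lt (degree_sub_le _ _) (max_lt hQ (hd _ ?_))) (hd _ ?_))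
        · rw [natDegree_pow, hm, mul_assoc]
          refine Nat.mul_lt_mul_of_pos_left (lt_of_lt_of_le hcn ?_) hp.pos
          exact Nat.le_mul_of_pos_left _ hm0
        · refine lt_of_le_of_lt natDegree_mul_le ?_
          rw [natDegree_pow]
          have : (e + 1) * P.natDegree = m * P.natDegree + (e + 1 - m) * P.natDegree := by
            rw [← add_mul, Nat.add_sub_cancel' hme.le]
          rw [this]
          exact Nat.add_lt_add_right (lt_of_lt_of_le hcn (Nat.le_mul_of_pos_left _ hm0)) _
      obtain ⟨a, b, ha, hab⟩ := hdiv (Q - c ^ p + c * P ^ (e + 1 - m))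
        (dvd_add hcd (Dvd.dvd.mul_left (dvd_pow_self P (by omega)) c)) hdeg
      refine ⟨a, b + algebraMap F[X] (RatFunc F) c / algebraMap F[X] (RatFunc F) P ^ m, ha, ?_⟩
      have h1 : algebraMap F[X] (RatFunc F) P ^ (e + 1) =
          algebraMap F[X] (RatFunc F) P ^ (e + 1 - m) * algebraMap F[X] (RatFunc F) P ^ m := by
        rw [← pow_add, Nat.sub_add_cancel hme.le]
      have h2 : algebraMap F[X] (RatFunc F) P ^ (e + 1) =
          (algebraMap F[X] (RatFunc F) P ^ m) ^ p := by
        rw [← pow_mul, hm, mul_comm]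
      have h3 : algebraMap F[X] (RatFunc F) (c * P ^ (e + 1 - m)) /
          algebraMap F[X] (RatFunc F) (P ^ (e + 1)) =
          algebraMap F[X] (RatFunc F) c / algebraMap F[X] (RatFunc F) P ^ m := by
        rw [map_pow, h1, map_mul, map_pow, mul_comm, mul_div_mul_left _ _ (pow_ne_zero _ hP0)]
      have h4 : algebraMap F[X] (RatFunc F) (c ^ p) /
          algebraMap F[X] (RatFunc F) (P ^ (e + 1)) =
          (algebraMap F[X] (RatFunc F) c / algebraMap F[X] (RatFunc F) P ^ m) ^ p := by
        rw [map_pow, map_pow, h2, div_pow]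
      rw [map_add, map_sub, add_div, sub_div, h3, h4] at hab
      rw [add_pow_char]
      linear_combination hab
    · refine ⟨_, 0, ⟨Q, e + 1, rfl, by simp, fun _ => ⟨hpe, ?_, hQ⟩⟩, by simp [hp.ne_zero]⟩
      exact ((hP.coprime_iff_not_dvd).2 hPQ).symm

/-- The same reduction at infinity: if `p` divides a positive degree, the leading term is a `p`-th
power, since `F` is perfect, and can be traded for a term of lower degree. -/
theorem exists_isNormalizedAtInfinity (f : F[X]) :
    ∃ a b : RatFunc F, IsNormalizedAtInfinity p a ∧
      algebraMap F[X] (RatFunc F) f = a + (b ^ p - b) := by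
  have hp : p.Prime := Fact.out
  have : CharP (RatFunc F) p := charP_of_injective_algebraMap (algebraMap F _).injective p
  induction hd : f.natDegree using Nat.strong_induction_on generalizing f with
  | _ d ih =>
    by_cases hf : (∃ c : F, f = C c) ∨ ¬ p ∣ f.natDegree
    · exact ⟨_, 0, ⟨f, rfl, fun h => hf.resolve_left h⟩, by simp [hp.ne_zero]⟩
    · push Not at hf
      obtain ⟨hf, m, hm⟩ := hf
      have hm0 : 0 < m := by
        rcases Nat.eq_zero_or_pos m with rfl | h
        · exact absurd (eq_C_of_natDegree_eq_zero (by simpa using hm)) (hf _)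
        · exact h
      obtain ⟨c, hc⟩ := surjective_frobenius F p f.leadingCoeff
      rw [frobenius_def] at hc
      have hf0 : f ≠ 0 := fun h => hf 0 (by simpa using h)
      have hmd : m < d := by
        rw [← hd, hm]
        exact lt_mul_of_one_lt_left hm0 hp.one_lt
      have hmono : (C c * X ^ m) ^ p = C f.leadingCoeff * X ^ f.natDegree := by
        rw [mul_pow, ← C_pow, hc, ← pow_mul, hm, mul_comm m]
      have hlt : (f - (C c * X ^ m) ^ p).natDegree < d := by
        rw [hmono, ← hd]
        have := eraseLead_natDegree_lt_or_eraseLead_eq_zero f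
        rw [← self_sub_C_mul_X_pow] at this
        rcases this with h | h
        · exact h
        · rw [h, natDegree_zero]
          omega
      obtain ⟨a, b, ha, hab⟩ := ih _ (show (f - (C c * X ^ m) ^ p + C c * X ^ m).natDegree < d by
        refine lt_of_le_of_lt (natDegree_add_le _ _) (max_lt hlt ?_)
        exact lt_of_le_of_lt (natDegree_C_mul_X_pow_le c m) hmd) _ rfl
      refine ⟨a, b + algebraMap F[X] (RatFunc F) (C c * X ^ m), ha, ?_⟩
      rw [map_add, map_sub, map_pow] at hab
      rw [add_pow_char]
      linear_combination hab

/-- Partial fractions, normalized modulo the image of `b ↦ b ^ p - b`. -/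
theorem exists_normalized_decomposition (x : RatFunc F) :
    ∃ (s : Finset F[X]) (a : F[X] → RatFunc F) (g b : RatFunc F),
      (∀ P ∈ s, P.Monic ∧ Irreducible P) ∧ (∀ P ∉ s, a P = 0) ∧
      (∀ P, IsNormalizedAt p P (a P)) ∧ IsNormalizedAtInfinity p g ∧
      x = ∑ P ∈ s, a P + g + (b ^ p - b) := by
  classical
  have hp : p.Prime := Fact.out
  have : CharP (RatFunc F) p := charP_of_injective_algebraMap (algebraMap F _).injective p
  let D := UniqueFactorizationMonoid.normalizedFactors x.denom
  let s := D.toFinset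
  have hs : ∀ P ∈ s, P.Monic ∧ Irreducible P := fun P hP => by
    have hP' : P ∈ D := Multiset.mem_toFinset.1 hP
    have hirr := UniqueFactorizationMonoid.irreducible_of_normalized_factor P hP'
    refine ⟨?_, hirr⟩
    rw [← UniqueFactorizationMonoid.normalize_normalized_factor P hP']
    exact monic_normalize hirr.ne_zero
  have hden : x.denom = ∏ P ∈ s, P ^ D.count P := by
    rw [← Finset.prod_multiset_count]
    have h := UniqueFactorizationMonoid.prod_normalizedFactors_eq x.denom_ne_zero
    rw [h, (RatFunc.monic_denom x).normalize_eq_self]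
  obtain ⟨q, r, hr, hsum⟩ := div_prod_eq_quo_add_sum_rem_div (RatFunc F) x.num
    (g := fun P => P ^ D.count P) (s := s) (fun P hP => (hs P hP).1.pow _) (by
      intro P hP P' hP' hne
      refine IsCoprime.pow ((hs P hP).2.coprime_iff_not_dvd.2 fun hdvd => hne ?_)
      exact eq_of_monic_of_associated (hs P hP).1 (hs P' hP').1
        ((hs P hP).2.associated_of_dvd (hs P' hP').2 hdvd))
  -- The local parts are defined for every `P`, with value 0 off `s`, so that families with
  -- different pole sets can be added later.
  have hloc : ∀ P, ∃ a b : RatFunc F, IsNormalizedAt p P a ∧ (P ∉ s → a = 0) ∧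
      (P ∈ s → algebraMap F[X] (RatFunc F) (r P) /
        algebraMap F[X] (RatFunc F) (P ^ D.count P) = a + (b ^ p - b)) := fun P => by
    by_cases hP : P ∈ s
    · obtain ⟨a, b, ha, hab⟩ := exists_isNormalizedAt (p := p) (hs P hP).2 _ _ (hr P hP)
      exact ⟨a, b, ha, fun h => absurd hP h, fun _ => hab⟩
    · exact ⟨0, 0, isNormalizedAt_zero p P, fun _ => rfl, fun h => absurd h hP⟩
  choose a b ha ha0 hab using hloc
  obtain ⟨g, c, hg, hgc⟩ := exists_isNormalizedAtInfinity (p := p) q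
  refine ⟨s, a, g, c + ∑ P ∈ s, b P, hs, ha0, ha, hg, ?_⟩
  have hx : x = algebraMap F[X] (RatFunc F) x.num /
      ∏ P ∈ s, algebraMap F[X] (RatFunc F) (P ^ D.count P) := by
    rw [← map_prod, ← hden, RatFunc.num_div_denom]
  have hsum' : ∑ P ∈ s, algebraMap F[X] (RatFunc F) (r P) /
      algebraMap F[X] (RatFunc F) (P ^ D.count P) =
      ∑ P ∈ s, a P + (∑ P ∈ s, b P ^ p - ∑ P ∈ s, b P) := by
    rw [← Finset.sum_sub_distrib, ← Finset.sum_add_distrib]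
    exact Finset.sum_congr rfl fun P hP => hab P hP
  have hsum2 : x = algebraMap F[X] (RatFunc F) q + ∑ P ∈ s, algebraMap F[X] (RatFunc F) (r P) /
      algebraMap F[X] (RatFunc F) (P ^ D.count P) := hx.trans hsum
  rw [hsum', hgc] at hsum2
  rw [add_pow_char, sum_pow_char]
  linear_combination hsum2

end CyclicWitt

/-! ### Pole orders of Artin–Schreier elements -/

namespace Valuation

open WithZero

variable {K : Type*} [Field K] (v : Valuation K ℤᵐ⁰)

theorem map_pow_sub_self {p : ℕ} (hp : 1 < p) {a : K} (ha : 1 < v a) :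
    v (a ^ p - a) = v a ^ p := by
  rw [← map_pow]
  refine v.map_sub_eq_of_lt_left ?_
  rw [map_pow]
  exact lt_self_pow₀ ha hp

theorem le_one_of_pow_sub_self_le_one {p : ℕ} (hp : 1 < p) {a : K} (ha : v (a ^ p - a) ≤ 1) :
    v a ≤ 1 := by
  by_contra! h
  rw [v.map_pow_sub_self hp h] at ha
  exact absurd ha (not_le.2 (one_lt_pow₀ h (by omega)))

/-- The element `d` has the same pole order as a^p - a. As this is positive, `a` itself has a pole,
and `a ^ p` dominates, so the order is `p` times that of `a`. -/
theorem dvd_of_pow_sub_self_sub_le_one {p : ℕ} (hp : 1 < p) {a d : K} {e : ℕ} (he : 0 < e)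
    (hd : v d = exp (e : ℤ)) (h : v (a ^ p - a - d) ≤ 1) : p ∣ e := by
  have hd1 : 1 < v d := by
    rw [hd, ← exp_zero, exp_lt_exp]
    exact_mod_cast he
  have h1 : v (a ^ p - a) = v d := by
    have := v.map_add_eq_of_lt_right (x := a ^ p - a - d) (y := d) (h.trans_lt hd1)
    rwa [sub_add_cancel] at this
  have ha : 1 < v a := by
    by_contra! ha
    have : v (a ^ p - a) ≤ 1 :=
      (v.map_sub _ _).trans (max_le (by rw [map_pow]; exact pow_le_one₀ zero_le ha) ha)
    rw [h1] at this
    exact absurd this (not_le.2 hd1)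
  rw [v.map_pow_sub_self hp ha, hd] at h1
  have hv0 : v a ≠ 0 := (zero_lt_one.trans ha).ne'
  rw [← exp_log hv0, ← exp_nsmul, exp_inj, nsmul_eq_mul] at h1
  exact Int.natCast_dvd_natCast.1 ⟨_, h1.symm⟩

end Valuation

/-! ### Vanishing at unramified primes, and the decomposition of a whole Witt vector -/

namespace CyclicWitt

open WithZero

variable {F : Type*} [Field F]

/-- The valuation is that of a prime `Q` of the integral closure above `P`; the value of `P` is
governed by the ramification index of `Q`, which is 1. -/
theorem exists_valuation_of_not_isRamified {K : Type*} [Field K] [Algebra (RatFunc F) K]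
    [Algebra F[X] K] [IsScalarTower F[X] (RatFunc F) K] [FiniteDimensional (RatFunc F) K]
    [Algebra.IsSeparable (RatFunc F) K] {P : F[X]} (hP : Irreducible P)
    (hunr : ¬ IsRamified F K P) :
    ∃ v : Valuation K ℤᵐ⁰, (∀ f : F[X], v (algebraMap F[X] K f) ≤ 1) ∧
      (∀ f : F[X], ¬ P ∣ f → v (algebraMap F[X] K f) = 1) ∧
      v (algebraMap F[X] K P) = exp (-1 : ℤ) := by
  let O := FunctionField.ringOfIntegers F K
  have hinj := FunctionField.ringOfIntegers.algebraMap_injective F K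
  have : FaithfulSMul F[X] O := (faithfulSMul_iff_algebraMap_injective _ _).2 hinj
  have : Algebra.IsIntegral F[X] O :=
    inferInstanceAs (Algebra.IsIntegral F[X] (integralClosure F[X] K))
  have : (Ideal.span {P}).IsMaximal := PrincipalIdealRing.isMaximal_of_irreducible hP
  obtain ⟨Q, hQ, hQP⟩ :=
    Ideal.exists_maximal_ideal_liesOver_of_isIntegral (S := O) (Ideal.span {P})
  have hmem : ∀ f : F[X], algebraMap F[X] O f ∈ Q ↔ P ∣ f := fun f => by
    rw [← Ideal.mem_span_singleton, Ideal.mem_of_liesOver Q (Ideal.span {P})]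
  have hP0 : algebraMap F[X] O P ≠ 0 := by
    rw [map_ne_zero_iff _ hinj]
    exact hP.ne_zero
  have hQ0 : Q ≠ ⊥ := fun h => hP0 (by simpa [h] using (hmem P).2 dvd_rfl)
  let w : IsDedekindDomain.HeightOneSpectrum O := ⟨Q, hQ.isPrime, hQ0⟩
  have hQprime : Q.IsPrime := hQ.isPrime
  have halg : ∀ f : F[X], algebraMap F[X] K f = algebraMap O K (algebraMap F[X] O f) :=
    fun f => rfl
  have hmap : (Ideal.span {P}).map (algebraMap F[X] O) = Ideal.span {algebraMap F[X] O P} := by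
    rw [Ideal.map_span, Set.image_singleton]
  have he : Q.ramificationIdx F[X] = 1 := by
    refine le_antisymm ?_ (Ideal.ramificationIdx_pos Q F[X])
    by_contra! h
    exact hunr ⟨Q, hQprime, hQP, h⟩
  rw [Ideal.IsDedekindDomain.ramificationIdx_eq_multiplicity (Ideal.span {P}) Q (by
    rw [hmap, Ne, Ideal.span_singleton_eq_bot]; exact hP0), hmap] at he
  refine ⟨w.valuation K, fun f => ?_, fun f hf => ?_, ?_⟩
  · rw [halg]
    exact w.valuation_le_one _
  · rw [halg, w.valuation_eq_one_iff_notMem]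
    exact fun h => hf ((hmem f).1 h)
  · rw [halg, w.valuation_of_algebraMap, w.intValuation_eq_exp_neg_multiplicity hP0, he]
    simp

variable {p : ℕ} [Fact p.Prime]

theorem coeff_eq_zero_of_not_isRamified {K : Type*} [Field K] [Algebra (RatFunc F) K]
    [CharP K p] [Algebra F[X] K] [IsScalarTower F[X] (RatFunc F) K]
    [FiniteDimensional (RatFunc F) K] [Algebra.IsSeparable (RatFunc F) K]
    {n : ℕ} {y : WittVector p K} {s : Finset F[X]} {δ : F[X] → WittVector p (RatFunc F)}
    {μ : WittVector p (RatFunc F)} (hs : ∀ P ∈ s, P.Monic ∧ Irreducible P)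
    (hδ : ∀ P i, IsNormalizedAt p P ((δ P).coeff i)) (hμ : ∀ i, IsNormalizedAtInfinity p (μ.coeff i))
    (h : WittVector.truncate n (WittVector.frobenius y - y) =
      WittVector.truncate n (WittVector.map (algebraMap (RatFunc F) K) (∑ P ∈ s, δ P + μ)))
    {P : F[X]} (hPs : P ∈ s) (hP : ¬ IsRamified F K P) (j : ℕ) (hj : j < n) :
    (δ P).coeff j = 0 := by
  classical
  have hp : p.Prime := Fact.out
  obtain ⟨v, hv1, hvP', hvP⟩ := exists_valuation_of_not_isRamified (hs P hPs).2 hP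
  simp only [IsScalarTower.algebraMap_apply F[X] (RatFunc F) K] at hv1 hvP' hvP
  let A : Subring K := v.integer
  let B : Subring (RatFunc F) := A.comap (algebraMap (RatFunc F) K)
  have hB : ∀ x, x ∈ B ↔ v (algebraMap (RatFunc F) K x) ≤ 1 := fun x => Iff.rfl
  have hμB : ∀ i, μ.coeff i ∈ B := fun i => by
    obtain ⟨f, hf, -⟩ := hμ i
    rw [hf]
    exact hv1 f
  have hδB : ∀ P' ∈ s.erase P, ∀ i, (δ P').coeff i ∈ B := fun P' hP' i => by
    obtain ⟨Q, e, hQ, -⟩ := hδ P' i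
    rw [hQ, hB, map_div₀, map_div₀, hvP' (P' ^ e), div_one]
    · exact hv1 Q
    · intro hdvd
      have hP's := hs P' (Finset.mem_of_mem_erase hP')
      have := (hs P hPs).2.prime.dvd_of_dvd_pow hdvd
      exact Finset.ne_of_mem_erase hP' (eq_of_monic_of_associated hP's.1 (hs P hPs).1
        ((hs P hPs).2.associated_of_dvd hP's.2 this).symm)
  have hsumB : ∀ i, (∑ P' ∈ s.erase P, δ P').coeff i ∈ B := by
    refine Finset.sum_induction _ (fun x : WittVector p (RatFunc F) => ∀ i, x.coeff i ∈ B)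
      (fun x y hx hy => WittVector.coeff_add_mem B hx hy) (fun i => ?_) hδB
    rw [WittVector.zero_coeff]
    exact B.zero_mem
  have hγ := WittVector.coeff_add_mem B hsumB hμB
  have h' : WittVector.truncate n (WittVector.frobenius y) = WittVector.truncate n
      (y + (WittVector.map (algebraMap (RatFunc F) K) (δ P) +
        WittVector.map (algebraMap (RatFunc F) K) (∑ P' ∈ s.erase P, δ P' + μ))) := by
    rw [← map_add, ← add_assoc, Finset.add_sum_erase s δ hPs, map_add, ← h, map_sub]
    ring
  -- Once the lower components of `δ P` vanish, component `j` differs from some a^p - a by an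
  -- integral element. A pole there would have order divisible by `p`, against normalization.
  induction j using Nat.strong_induction_on with
  | _ j ih =>
    have key := WittVector.artinSchreier_coeff_mem A
      (fun a ha => v.le_one_of_pow_sub_self_le_one hp.one_lt ha) h' (fun i _ => by
        rw [WittVector.map_coeff]
        exact hγ i) hj (fun i hi => by
        rw [WittVector.map_coeff, ih i hi (hi.trans hj), map_zero]
        exact A.zero_mem)
    obtain ⟨Q, e, hQ, he0, he⟩ := hδ P j
    rcases Nat.eq_zero_or_pos e with h0 | hpos
    · rw [hQ, he0 h0]
      simp
    · obtain ⟨hpe, hcop, -⟩ := he hpos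
      refine absurd (v.dvd_of_pow_sub_self_sub_le_one hp.one_lt hpos ?_ key) hpe
      rw [WittVector.map_coeff, hQ, map_div₀, map_div₀, map_pow, map_pow, map_pow, hvP, hvP' Q,
        ← exp_nsmul, one_div, ← exp_neg]
      · simp
      · exact (hs P hPs).2.coprime_iff_not_dvd.1 hcop.symm

/-- The error after `n` components is an n-fold Verschiebung, and the scalar decomposition of its
leading component supplies the next one. The corrections are shifted Teichmüller lifts; since `δ`
and `μ` vanish from index `n` on, adding them only fills slot `n` and leaves the normalized lower
components untouched. This is why the vanishing is carried in the induction. -/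
theorem exists_witt_decomposition [Finite F] [CharP F p] (β : WittVector p (RatFunc F)) (n : ℕ) :
    ∃ (s : Finset F[X]) (δ : F[X] → WittVector p (RatFunc F)) (μ z : WittVector p (RatFunc F)),
      (∀ P ∈ s, P.Monic ∧ Irreducible P) ∧ (∀ P ∉ s, δ P = 0) ∧
      (∀ P i, IsNormalizedAt p P ((δ P).coeff i)) ∧
      (∀ i, IsNormalizedAtInfinity p (μ.coeff i)) ∧
      (∀ P i, n ≤ i → (δ P).coeff i = 0) ∧ (∀ i, n ≤ i → μ.coeff i = 0) ∧
      WittVector.truncate n β =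
        WittVector.truncate n (∑ P ∈ s, δ P + μ + (WittVector.frobenius z - z)) := by
  classical
  have : CharP (RatFunc F) p := charP_of_injective_algebraMap (algebraMap F _).injective p
  induction n with
  | zero =>
    refine ⟨∅, 0, 0, 0, by simp, by simp, ?_, ?_, by simp, by simp, ?_⟩
    · simp [isNormalizedAt_zero]
    · simp [isNormalizedAtInfinity_zero]
    · exact WittVector.truncate_eq_truncate_iff.2 (by simp)
  | succ n ih =>
    obtain ⟨s, δ, μ, z, hs, hδs, hδ, hμ, hδn, hμn, h⟩ := ih
    obtain ⟨V, hV⟩ : ∃ V : WittVector p (RatFunc F) →+ WittVector p (RatFunc F),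
        ∀ x, V x = WittVector.verschiebung^[n] x := by
      let φ : AddMonoid.End (WittVector p (RatFunc F)) := WittVector.verschiebung
      exact ⟨φ ^ n, fun x => congrFun (AddMonoid.End.coe_pow _ φ n) x⟩
    -- Frobenius commutes with Verschiebung, so the shifted Artin–Schreier term is absorbed into
    -- `z`.
    have hVF : ∀ x, WittVector.frobenius (V x) = V (WittVector.frobenius x) := fun x => by
      rw [hV, hV]
      exact ((WittVector.verschiebung_frobenius_comm (p := p) (R := RatFunc F)).iterate_left n x).symm
    have hVlt : ∀ x i, i < n → (V x).coeff i = 0 := fun x i hi => by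
      rw [hV, WittVector.iterate_verschiebung_coeff_eq_zero _ hi]
    have hVge : ∀ x i, (V x).coeff (i + n) = x.coeff i := fun x i => by
      rw [hV, WittVector.iterate_verschiebung_coeff]
    obtain ⟨R, hR⟩ : ∃ R, β - (∑ P ∈ s, δ P + μ + (WittVector.frobenius z - z)) = V R := by
      refine ⟨_, (WittVector.eq_iterate_verschiebung (n := n) fun i hi => ?_).trans (hV _).symm⟩
      exact (WittVector.mem_ker_truncate n _).1
        (by rw [RingHom.mem_ker, map_sub, h, sub_self]) i hi
    obtain ⟨s', a, g, b, hs', has, ha, hg, hx⟩ := exists_normalized_decomposition (p := p) (R.coeff 0)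
    let τ : RatFunc F → WittVector p (RatFunc F) := fun x => WittVector.teichmuller p x
    have hτ0 : ∀ x, (τ x).coeff 0 = x := fun x => WittVector.teichmuller_coeff_zero p x
    have hτ : ∀ x i, 0 < i → (τ x).coeff i = 0 :=
      fun x i hi => WittVector.teichmuller_coeff_pos p x i hi
    have hcoeff : ∀ (x : WittVector p (RatFunc F)) (c : RatFunc F),
        (∀ i, n ≤ i → x.coeff i = 0) →
        ∀ i, (x + V (τ c)).coeff i = if i < n then x.coeff i else if i = n then c else 0 := by
      intro x c hx i
      rw [WittVector.coeff_add_of_disjoint]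
      · split_ifs with h1 h2
        · rw [hVlt _ _ h1, add_zero]
        · rw [hx i (by omega), zero_add]
          have := hVge (τ c) 0
          rwa [zero_add, ← h2, hτ0] at this
        · obtain ⟨l, rfl⟩ := Nat.exists_eq_add_of_le' (not_lt.1 h1)
          rw [hx _ (by omega), zero_add, hVge, hτ _ _ (by omega)]
      · intro i
        rcases lt_or_ge i n with hi | hi
        · exact Or.inr (hVlt _ _ hi)
        · exact Or.inl (hx i hi)
    refine ⟨s ∪ s', fun P => δ P + V (τ (a P)), μ + V (τ g), z + V (τ b), ?_, ?_, ?_, ?_, ?_, ?_, ?_⟩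
    · intro P hP
      exact (Finset.mem_union.1 hP).elim (hs P) (hs' P)
    · intro P hP
      rw [Finset.mem_union, not_or] at hP
      simp [hδs P hP.1, has P hP.2, τ]
    · intro P i
      rw [hcoeff _ _ (hδn P)]
      split_ifs
      exacts [hδ P i, ha P, isNormalizedAt_zero p P]
    · intro i
      rw [hcoeff _ _ hμn]
      split_ifs
      exacts [hμ i, hg, isNormalizedAtInfinity_zero p]
    · intro P i hi
      rw [hcoeff _ _ (hδn P), if_neg (by omega), if_neg (by omega)]
    · intro i hi
      rw [hcoeff _ _ hμn, if_neg (by omega), if_neg (by omega)]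
    -- The new error is the n-fold Verschiebung of `T`, and `T` has component 0 equal to zero, so it
    -- vanishes in length `n + 1`.
    · let T := R - (∑ P ∈ s', τ (a P) + τ g + (WittVector.frobenius (τ b) - τ b))
      have hT0 : T.coeff 0 = 0 := by
        change WittVector.constantCoeff T = 0
        have hc : ∀ x, WittVector.constantCoeff (τ x) = x := hτ0
        have hcF : WittVector.constantCoeff (WittVector.frobenius (τ b)) = b ^ p := by
          change (WittVector.frobenius (τ b)).coeff 0 = _
          rw [WittVector.coeff_frobenius_charP, hτ0]
        have hR0 : WittVector.constantCoeff R = R.coeff 0 := rfl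
        simp only [T, map_sub, map_add, map_sum, hc, hcF, hR0]
        rw [hx, sub_self]
      have h1 : ∑ P ∈ s ∪ s', δ P = ∑ P ∈ s, δ P :=
        (Finset.sum_subset Finset.subset_union_left fun P _ hP => hδs P hP).symm
      have h2 : ∑ P ∈ s ∪ s', V (τ (a P)) = V (∑ P ∈ s', τ (a P)) := by
        rw [map_sum]
        refine (Finset.sum_subset Finset.subset_union_right fun P _ hP => ?_).symm
        simp [has P hP, τ]
      have hVT : β - (∑ P ∈ s ∪ s', (δ P + V (τ (a P))) + (μ + V (τ g)) +
          (WittVector.frobenius (z + V (τ b)) - (z + V (τ b)))) = V T := by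
        rw [Finset.sum_add_distrib, h1, h2, map_add WittVector.frobenius, hVF]
        simp only [T, map_sub, map_add]
        linear_combination hR
      rw [← sub_eq_zero, ← map_sub, hVT, ← RingHom.mem_ker, WittVector.mem_ker_truncate]
      intro i hi
      rcases lt_or_eq_of_le (Nat.lt_succ_iff.1 hi) with hi | rfl
      · exact hVlt _ _ hi
      · have := hVge T 0
        rwa [zero_add, hT0] at this

end CyclicWitt

/-! ### Galois action on the Witt generator -/

namespace CyclicWitt

variable {p : ℕ} [Fact p.Prime]

theorem truncate_map_congr {R S : Type*} [CommRing R] [CommRing S] (f : R →+* S) {n : ℕ}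
    {x y : WittVector p R} (h : WittVector.truncate n x = WittVector.truncate n y) :
    WittVector.truncate n (WittVector.map f x) = WittVector.truncate n (WittVector.map f y) := by
  rw [WittVector.truncate_eq_truncate_iff] at h ⊢
  intro i hi
  rw [WittVector.map_coeff, WittVector.map_coeff, h i hi]

theorem truncate_frobenius_congr {R : Type*} [CommRing R] [CharP R p] {n : ℕ}
    {x y : WittVector p R} (h : WittVector.truncate n x = WittVector.truncate n y) :
    WittVector.truncate n (WittVector.frobenius x) =
      WittVector.truncate n (WittVector.frobenius y) := by
  rw [WittVector.truncate_eq_truncate_iff] at h ⊢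
  intro i hi
  rw [WittVector.coeff_frobenius_charP, WittVector.coeff_frobenius_charP, h i hi]

/-- The part of `m` prime to `p` is a unit, and `p ^ a` has component `a` equal to 1. -/
theorem pow_dvd_of_truncate_natCast_eq_zero (K : Type*) [Field K] [CharP K p] {n m : ℕ}
    (h : WittVector.truncate n (m : WittVector p K) = 0) : p ^ n ∣ m := by
  have hp : p.Prime := Fact.out
  rcases eq_or_ne m 0 with rfl | hm
  · exact dvd_zero _
  obtain ⟨a, u, hu, rfl⟩ := Nat.exists_eq_pow_mul_and_not_dvd hm p hp.ne_one
  suffices hna : n ≤ a from Dvd.dvd.mul_right (pow_dvd_pow p hna) u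
  by_contra! hna
  have hunit : IsUnit (u : WittVector p K) := by
    refine WittVector.isUnit_of_coeff_zero_ne_zero _ ?_
    change WittVector.constantCoeff (u : WittVector p K) ≠ 0
    rwa [map_natCast, Ne, CharP.cast_eq_zero_iff K p]
  rw [Nat.cast_mul, map_mul, (hunit.map (WittVector.truncate n)).mul_left_eq_zero, Nat.cast_pow,
    ← RingHom.mem_ker, WittVector.mem_ker_truncate] at h
  exact one_ne_zero ((WittVector.coeff_p_pow p K a).symm.trans (h a hna))

variable {k K : Type*} [Field k] [Field K] [Algebra k K] {n : ℕ}
  {σ : K ≃ₐ[k] K} {y : WittVector p K}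

theorem exists_base_truncate_eq [FiniteDimensional k K] [IsGalois k K]
    (hσ : ∀ τ, τ ∈ Subgroup.zpowers σ) {x : WittVector p K}
    (hx : WittVector.truncate n (WittVector.map (σ : K →+* K) x) = WittVector.truncate n x) :
    ∃ β : WittVector p k,
      WittVector.truncate n x = WittVector.truncate n (WittVector.map (algebraMap k K) β) := by
  have hfix : ∀ i < n, ∃ b : k, algebraMap k K b = x.coeff i := fun i hi => by
    refine (IsGalois.mem_range_algebraMap_iff_fixed (F := k) (E := K) _).2 fun τ => ?_
    have h1 : σ ∈ MulAction.stabilizer (K ≃ₐ[k] K) (x.coeff i) := by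
      have := WittVector.truncate_eq_truncate_iff.1 hx i hi
      rwa [WittVector.map_coeff] at this
    exact (Subgroup.zpowers_le.2 h1) (hσ τ)
  choose b hb using hfix
  refine ⟨WittVector.mk p fun i => if hi : i < n then b i hi else 0, ?_⟩
  rw [WittVector.truncate_eq_truncate_iff]
  intro i hi
  rw [WittVector.map_coeff, WittVector.coeff_mk, dif_pos hi, hb]

variable [CharP K p]

/-- Since σ^m y = y + m in length `n`, a power σ^m fixing all components has `p ^ n` dividing `m`,
hence is trivial; the Galois correspondence concludes. -/
theorem adjoin_coeff_eq_top [FiniteDimensional k K] [IsGalois k K]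
    (hdeg : Module.finrank k K = p ^ n) (hσ : ∀ τ, τ ∈ Subgroup.zpowers σ)
    (hy : WittVector.truncate n (WittVector.map (σ : K →+* K) y) = WittVector.truncate n (y + 1)) :
    IntermediateField.adjoin k (Set.range fun j : Fin n => y.coeff j) = ⊤ := by
  set L := IntermediateField.adjoin k (Set.range fun j : Fin n => y.coeff j)
  have hord : orderOf σ = p ^ n := by
    rw [orderOf_eq_card_of_forall_mem_zpowers hσ, IsGalois.card_aut_eq_finrank, hdeg]
  have hpow : ∀ m : ℕ, WittVector.truncate n
      (WittVector.map ((σ ^ m : K ≃ₐ[k] K) : K →+* K) y) =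
        WittVector.truncate n (y + (m : WittVector p K)) := by
    intro m
    induction m with
    | zero =>
      rw [Nat.cast_zero, add_zero]
      congr 1
    | succ m ih =>
      have h1 : WittVector.map ((σ ^ (m + 1) : K ≃ₐ[k] K) : K →+* K) y =
          WittVector.map (σ : K →+* K) (WittVector.map ((σ ^ m : K ≃ₐ[k] K) : K →+* K) y) := by
        ext i
        simp only [WittVector.map_coeff, pow_succ']
        rfl
      rw [h1, truncate_map_congr _ ih, map_add, map_add, hy, map_natCast, ← map_add]
      push_cast
      congr 1
      ring
  have hbot : L.fixingSubgroup = ⊥ := by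
    rw [eq_bot_iff]
    intro τ hτ
    obtain ⟨m, rfl⟩ := (isOfFinOrder_of_finite σ).mem_powers_iff_mem_zpowers.2 (hσ τ)
    dsimp only at hτ ⊢
    have h1 : WittVector.truncate n (WittVector.map ((σ ^ m : K ≃ₐ[k] K) : K →+* K) y) =
        WittVector.truncate n y := by
      rw [WittVector.truncate_eq_truncate_iff]
      intro i hi
      rw [WittVector.map_coeff]
      exact (IntermediateField.mem_fixingSubgroup_iff L _).1 hτ _
        (IntermediateField.subset_adjoin k _ ⟨⟨i, hi⟩, rfl⟩)
    rw [hpow, map_add, add_eq_left] at h1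
    have h2 := pow_dvd_of_truncate_natCast_eq_zero K h1
    rw [← hord] at h2
    exact Subgroup.mem_bot.2 (orderOf_dvd_iff_pow_eq_one.1 h2)
  rw [← IsGalois.fixedField_fixingSubgroup L, hbot, IntermediateField.fixedField_bot]

/-- Otherwise t - a is a root of X^p - X, hence lies in the prime field and is fixed by σ, which
however moves it by 1. -/
theorem pow_sub_self_ne_of_map_eq_add_one {t : K} (ht : σ t = t + 1) (a : k) :
    t ^ p - t ≠ algebraMap k K (a ^ p - a) := by
  intro h
  have hu : (t - algebraMap k K a) ^ p = t - algebraMap k K a := by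
    rw [sub_pow_char, ← map_pow]
    rw [map_sub] at h
    linear_combination h
  have hmem : t - algebraMap k K a ∈ RingHom.eqLocusField (σ : K →+* K) (RingHom.id K) :=
    (bot_le : (⊥ : Subfield K) ≤ _) ((Subfield.mem_bot_iff_pow_eq_self K p).2 hu)
  have : σ (t - algebraMap k K a) = t - algebraMap k K a := hmem
  rw [map_sub, ht, AlgEquiv.commutes] at this
  exact one_ne_zero (α := K) (by linear_combination this)

end CyclicWitt

theorem theorem5p3p1
    (p : ℕ) [Fact p.Prime]
    (F : Type*) [Field F] [Finite F] [CharP F p]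
    (K : Type*) [Field K] [Algebra (RatFunc F) K]
    [Algebra F[X] K] [IsScalarTower F[X] (RatFunc F) K]
    (n : ℕ) (hn : 0 < n)
    -- `K/k` is cyclic of degree `p ^ n`, where `k = F(X)`
    [IsGalois (RatFunc F) K] [IsCyclic (K ≃ₐ[RatFunc F] K)]
    (hdeg : Module.finrank (RatFunc F) K = p ^ n)
    -- `P 1, …, P r` are the distinct finite primes that ramify in `K/k`
    (r : ℕ) (P : Fin r → F[X]) (hP_inj : Function.Injective P)
    (hP : ∀ A : F[X], (∃ i, P i = A) ↔
      A.Monic ∧ Irreducible A ∧ CyclicWitt.IsRamified F K A) :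
    ∃ (y : TruncatedWittVector p n K)
      (β : TruncatedWittVector p n (RatFunc F))
      (δ : Fin r → TruncatedWittVector p n (RatFunc F))
      (μ : TruncatedWittVector p n (RatFunc F))
      (Q : Fin r → Fin n → F[X]) (e : Fin r → Fin n → ℕ) (f : Fin n → F[X]),
      -- `K = k(y)`
      IntermediateField.adjoin (RatFunc F) (Set.range fun j => y.coeff j) = ⊤ ∧
      -- `y ^ p - y = β = δ 1 + ⋯ + δ r + μ` in the ring of Witt vectors of length `n`
      CyclicWitt.wittFrob y - y = CyclicWitt.wittMap (algebraMap (RatFunc F) K) β ∧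
      β = (∑ i, δ i) + μ ∧
      -- the first component of `β` is not of the form `a ^ p - a`
      (¬ ∃ a : RatFunc F, a ^ p - a = β.coeff ⟨0, hn⟩) ∧
      -- the components of the `δ i` are normalized, with no pole outside `P i`
      (∀ i j, (δ i).coeff j =
          algebraMap F[X] (RatFunc F) (Q i j) / algebraMap F[X] (RatFunc F) (P i ^ e i j)) ∧
      (∀ i j, e i j = 0 → Q i j = 0) ∧
      (∀ i j, 0 < e i j →
          ¬ p ∣ e i j ∧ IsCoprime (Q i j) (P i) ∧ (Q i j).degree < (P i ^ e i j).degree) ∧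
      -- the components of `μ` are normalized polynomials
      (∀ j, μ.coeff j = algebraMap F[X] (RatFunc F) (f j)) ∧
      (∀ j, (¬ ∃ c : F, f j = C c) → ¬ p ∣ (f j).natDegree) := by
  classical
  have hp : p.Prime := Fact.out
  have : FiniteDimensional (RatFunc F) K :=
    Module.finite_of_finrank_pos (hdeg ▸ pow_pos hp.pos n)
  have : CharP (RatFunc F) p := charP_of_injective_algebraMap (algebraMap F _).injective p
  have : CharP K p := charP_of_injective_algebraMap (algebraMap (RatFunc F) K).injective p
  obtain ⟨σ, hσ⟩ := IsCyclic.exists_generator (α := K ≃ₐ[RatFunc F] K)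
  obtain ⟨w, hw⟩ := WittVector.exists_map_eq_add_one (p := p) hdeg hσ
  have hfrob : ∀ x : WittVector p K, WittVector.map (σ : K →+* K) (WittVector.frobenius x) =
      WittVector.frobenius (WittVector.map (σ : K →+* K) x) := fun x => by
    ext i
    simp only [WittVector.map_coeff, WittVector.coeff_frobenius_charP, map_pow]
  have hfrob' : ∀ x : WittVector p (RatFunc F),
      WittVector.map (algebraMap (RatFunc F) K) (WittVector.frobenius x) =
      WittVector.frobenius (WittVector.map (algebraMap (RatFunc F) K) x) := fun x => by
    ext i
    simp only [WittVector.map_coeff, WittVector.coeff_frobenius_charP, map_pow]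
  obtain ⟨β₀, hβ₀⟩ := CyclicWitt.exists_base_truncate_eq (n := n) hσ
    (x := WittVector.frobenius w - w) (by
      rw [map_sub, map_sub, hfrob, CyclicWitt.truncate_frobenius_congr hw, hw, map_add, map_one,
        map_sub, map_add, map_add]
      ring)
  obtain ⟨s, δ, μ, z, hs, hδs, hδ, hμ, -, -, hdec⟩ := CyclicWitt.exists_witt_decomposition β₀ n
  -- Subtracting `z` cancels the Artin–Schreier term of the decomposition. As `z` has components in
  -- k, the relation σy = y + 1 survives.
  set y := w - WittVector.map (algebraMap (RatFunc F) K) z with hy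
  have hσy : WittVector.truncate n (WittVector.map (σ : K →+* K) y) =
      WittVector.truncate n (y + 1) := by
    have hz : WittVector.map (σ : K →+* K) (WittVector.map (algebraMap (RatFunc F) K) z) =
        WittVector.map (algebraMap (RatFunc F) K) z := by
      ext i
      simp only [WittVector.map_coeff]
      exact σ.commutes _
    rw [hy, map_sub, hz, map_sub, hw, ← map_sub, sub_add_eq_add_sub]
  have hyβ : WittVector.truncate n (WittVector.frobenius y - y) = WittVector.truncate n
      (WittVector.map (algebraMap (RatFunc F) K) (∑ P ∈ s, δ P + μ)) := by
    have h1 : WittVector.frobenius y - y = (WittVector.frobenius w - w) -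
        WittVector.map (algebraMap (RatFunc F) K) (WittVector.frobenius z - z) := by
      rw [hy, map_sub, map_sub, hfrob']
      ring
    have h2 := CyclicWitt.truncate_map_congr (algebraMap (RatFunc F) K) hdec
    rw [map_add (WittVector.map (algebraMap (RatFunc F) K)) (∑ P ∈ s, δ P + μ),
      map_add (WittVector.truncate n)] at h2
    rw [h1, map_sub (WittVector.truncate n), hβ₀, h2, add_sub_cancel_right]
  have hunr : ∀ A ∈ s, A ∉ Finset.univ.image P → WittVector.truncate n (δ A) = 0 := by
    intro A hA hAP
    rw [← RingHom.mem_ker, WittVector.mem_ker_truncate]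
    refine CyclicWitt.coeff_eq_zero_of_not_isRamified hs hδ hμ hyβ hA fun hram => hAP ?_
    obtain ⟨i, rfl⟩ := (hP A).2 ⟨(hs A hA).1, (hs A hA).2, hram⟩
    exact Finset.mem_image_of_mem P (Finset.mem_univ i)
  -- Both sums equal the sum over the union of `s` and the ramified primes: off `s` the vector `δ A`
  -- is zero, and at unramified members of `s` it vanishes after truncation.
  have hsum : WittVector.truncate n (∑ A ∈ s, δ A) = ∑ i, WittVector.truncate n (δ (P i)) := by
    rw [map_sum, ← Finset.sum_image (f := fun A => WittVector.truncate n (δ A)) hP_inj.injOn,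
      Finset.sum_subset (Finset.subset_union_left (s₂ := Finset.univ.image P)) fun A _ hA => by
        rw [hδs A hA, map_zero]]
    refine (Finset.sum_subset Finset.subset_union_right fun A hA hA' => ?_).symm
    exact hunr A ((Finset.mem_union.1 hA).resolve_right hA') hA'
  choose Q e hQ he0 he using hδ
  choose f hf hf' using hμ
  refine ⟨WittVector.truncate n y, WittVector.truncate n (∑ A ∈ s, δ A + μ),
    fun i => WittVector.truncate n (δ (P i)), WittVector.truncate n μ,
    fun i j => Q (P i) j, fun i j => e (P i) j, fun j => f j, ?_, ?_, ?_, ?_, ?_, ?_, ?_, ?_, ?_⟩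
  · simp only [WittVector.coeff_truncate]
    exact CyclicWitt.adjoin_coeff_eq_top hdeg hσ hσy
  · have h1 : CyclicWitt.wittFrob (WittVector.truncate n y) =
        WittVector.truncate n (WittVector.frobenius y) := by
      refine TruncatedWittVector.ext fun j => ?_
      rw [CyclicWitt.wittFrob, TruncatedWittVector.coeff_mk, WittVector.coeff_truncate,
        WittVector.coeff_truncate, WittVector.coeff_frobenius_charP]
    rw [h1, ← map_sub, hyβ]
    refine TruncatedWittVector.ext fun j => ?_
    rw [CyclicWitt.wittMap, TruncatedWittVector.coeff_mk, WittVector.coeff_truncate,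
      WittVector.coeff_truncate, WittVector.map_coeff]
  · rw [map_add, hsum]
  · rintro ⟨a, ha⟩
    rw [WittVector.coeff_truncate] at ha
    have h1 := WittVector.truncate_eq_truncate_iff.1 hσy 0 hn
    rw [WittVector.map_coeff, WittVector.add_coeff_zero, WittVector.one_coeff_zero] at h1
    have h2 := WittVector.truncate_eq_truncate_iff.1 hyβ 0 hn
    have h3 : (WittVector.frobenius y - y).coeff 0 = y.coeff 0 ^ p - y.coeff 0 := by
      change WittVector.constantCoeff (WittVector.frobenius y - y) = _
      rw [map_sub, WittVector.constantCoeff_apply, WittVector.constantCoeff_apply,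
        WittVector.coeff_frobenius_charP]
    rw [WittVector.map_coeff, h3] at h2
    exact CyclicWitt.pow_sub_self_ne_of_map_eq_add_one (p := p) h1 a (by rw [h2, ha])
  · intro i j
    rw [WittVector.coeff_truncate]
    exact hQ (P i) j
  · exact fun i j => he0 (P i) j
  · exact fun i j => he (P i) j
  · intro j
    rw [WittVector.coeff_truncate]
    exact hf j
  · exact fun j => hf' j
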